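/- Let $G$ be a (real, finite-dimensional) Lie group with Lie algebra $\mathfrak g=T_eG$, let $M$ be a smooth manifold and let $\pi:P\to M$ be a smooth $G$-principal fibre bundle: $P$ is a smooth manifold with a smooth right action of $G$, $\pi$ is a smooth surjection, and every point of $M$ has an open neighbourhood $U$ with a diffeomorphism $\phi:\pi^{-1}(U)\to U\times G$ that commutes with the projections to $U$ and with the right actions of $G$. For $g\in G$ let $\mathfrak{ad}_g:\mathfrak g\to\mathfrak g$ be the differential at $e$ of $h\mapsto ghg^{-1}$ and $R_g:P\to P$, $p\mapsto pg$; let $\theta$ be the Maurer–Cartan form of $G$, $\theta_g=d(L_{g^{-1}})_g:T_gG\to\mathfrak g$; for $A\in\mathfrak g$ let $A^*$ be the fundamental vector field on $P$, where $A^*_p$ is the image of $A$ under the differential at $e$ of $g\mapsto pg$. A local section on an open set $U\subseteq M$ is a smooth map $\sigma_U:U\to P$ with $\pi\circ\sigma_U=\mathrm{id}_U$. A *local connection* on $P$ is a family consisting of a smooth $\mathfrak g$-valued $1$-form $\omega_U$ on $U$ for each local section $\sigma_U:U\to P$ such that, for any two local sections $\sigma_U,\sigma_V$ with $\sigma_V=\sigma_U\,g_{UV}$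 on $U\cap V$, where $g_{UV}:U\cap V\to G$ is smooth, $$\omega_V=g_{UV}^*\theta+\mathfrak{ad}_{g_{UV}^{-1}}\,\omega_U\quad\text{on }U\cap V. \tag{1}$$ A *principal connection form* on $P$ is a smooth $\mathfrak g$-valued $1$-form $\omega$ on $P$ such that $\omega(A^*)=A$ for all $A\in\mathfrak g$ and $R_g^*\omega=\mathfrak{ad}_{g^{-1}}\,\omega$ for all $g\in G$. These two notions are equivalent: 1. For every local connection $(\omega_U)$ there is exactly one principal connection form $\omega$ on $P$ with $\omega_U=\sigma_U^*\omega$ for every local section $\sigma_U$. 2. Conversely, for every principal connection form $\omega$ on $P$, the forms $\omega_U=\sigma_U^*\omega$ are a local connection. 3. The gluing in 1 needs only sections that cover $M$: if $(\sigma_i:U_i\to P)_{i\in I}$ is a family of local sections with $\bigcup_iU_i=M$ and $(\omega_i)_{i\in I}$ are smooth $\mathfrak g$-valued $1$-forms on the $U_i$ that satisfy (1) for all pairs $i,j\in I$, then there is exactly one principal connection form $\omega$ on $P$ with $\omega_i=\sigma_i^*\omega$ for all $i\in I$. -/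

import Mathlib

open scoped Manifold ContDiff RightActions

noncomputable section

namespace PrincipalConn

section Forms

variable {EG : Type*} [NormedAddCommGroup EG] [NormedSpace ℝ EG]
  {HG : Type*} [TopologicalSpace HG] (IG : ModelWithCorners ℝ EG HG)
  (G : Type*) [TopologicalSpace G] [ChartedSpace HG G] [Group G]
  {EN : Type*} [NormedAddCommGroup EN] [NormedSpace ℝ EN]
  {HN : Type*} [TopologicalSpace HN] (IN : ModelWithCorners ℝ EN HN)
  (N : Type*) [TopologicalSpace N] [ChartedSpace HN N]

/-- A (not necessarily smooth) `1`-form on the manifold `N` with values in the Lie algebra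
`𝔤 = T₁G` of `G`: a linear map `T_xN → 𝔤` for each `x`. -/
abbrev LieForm : Type _ := ∀ x : N, TangentSpace IN x →L[ℝ] GroupLieAlgebra IG G

variable {IG G IN N}

/-- A `𝔤`-valued `1`-form is smooth on the set `U` if it is a smooth section over `U` of the vector
bundle `Hom(TN, N × 𝔤)`. (In Mathlib the vector space underlying `𝔤 = T₁G` is the model space
`EG` of `G`, which provides the norm.) -/
def LieForm.SmoothOn [IsManifold IN ∞ N] (α : LieForm IG G IN N) (U : Set N) : Prop :=
  ContMDiffOn IN (IN.prod 𝓘(ℝ, EN →L[ℝ] EG)) ∞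
    (fun x ↦ (Bundle.TotalSpace.mk' (EN →L[ℝ] EG) x (α x) :
      Bundle.TotalSpace (EN →L[ℝ] EG)
        (fun x : N ↦ TangentSpace IN x →L[ℝ] Bundle.Trivial N EG x))) U

end Forms

section Group

variable {EG : Type*} [NormedAddCommGroup EG] [NormedSpace ℝ EG]
  {HG : Type*} [TopologicalSpace HG] (IG : ModelWithCorners ℝ EG HG)
  {G : Type*} [TopologicalSpace G] [ChartedSpace HG G] [Group G]

/-- The Maurer–Cartan form of `G`: `θ_g = d(L_{g⁻¹})_g : T_gG → T_{g⁻¹g}G = 𝔤`. -/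
def maurerCartan : LieForm IG G IG G := fun g ↦
  (mfderiv IG IG (fun h : G ↦ g⁻¹ * h) g : TangentSpace IG g →L[ℝ] TangentSpace IG (g⁻¹ * g))

/-- The adjoint action `𝔞𝔡_g : 𝔤 → 𝔤`, the differential at `1` of `h ↦ g h g⁻¹`. -/
def ad (g : G) : GroupLieAlgebra IG G →L[ℝ] GroupLieAlgebra IG G :=
  (mfderiv IG IG (fun h : G ↦ g * h * g⁻¹) 1 :
    TangentSpace IG (1 : G) →L[ℝ] TangentSpace IG (g * 1 * g⁻¹))

end Group

section Bundle

variable {EG : Type*} [NormedAddCommGroup EG] [NormedSpace ℝ EG]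
  {HG : Type*} [TopologicalSpace HG] (IG : ModelWithCorners ℝ EG HG)
  {G : Type*} [TopologicalSpace G] [ChartedSpace HG G] [Group G]
  {EM : Type*} [NormedAddCommGroup EM] [NormedSpace ℝ EM]
  {HM : Type*} [TopologicalSpace HM] (IM : ModelWithCorners ℝ EM HM)
  {M : Type*} [TopologicalSpace M] [ChartedSpace HM M]
  {EP : Type*} [NormedAddCommGroup EP] [NormedSpace ℝ EP]
  {HP : Type*} [TopologicalSpace HP] (IP : ModelWithCorners ℝ EP HP)
  {P : Type*} [TopologicalSpace P] [ChartedSpace HP P] [MulAction Gᵐᵒᵖ P]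

/-- A bundle chart `(φ, U)`: a diffeomorphism `φ : π⁻¹(U) → U × G`, with `U ⊆ M` open, which
commutes with the projections to `U` and with the right actions of `G`. Here `U = φ.baseSet`, and
compatibility with the projections is part of `Bundle.Trivialization`. -/
structure IsBundleChart {π : P → M} (φ : Bundle.Trivialization G π) : Prop where
  smooth : ContMDiffOn IP (IM.prod IG) ∞ φ φ.source
  smooth_symm : ContMDiffOn (IM.prod IG) IP ∞ φ.toOpenPartialHomeomorph.symm φ.target
  mem_source : ∀ p ∈ φ.source, ∀ g : G, p <• g ∈ φ.source
  equivariant : ∀ p ∈ φ.source, ∀ g : G, φ (p <• g) = ((φ p).1, (φ p).2 * g)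

variable (G) in
/-- `π : P → M`, together with the given right action of `G` on `P` (that is, the given action of
`Gᵐᵒᵖ`, with `p <• g = p · g`), is a smooth `G`-principal fibre bundle. -/
structure IsPrincipalBundle (π : P → M) : Prop where
  smooth_proj : ContMDiff IP IM ∞ π
  surjective_proj : Function.Surjective π
  smooth_action : ContMDiff (IP.prod IG) IP ∞ (fun q : P × G ↦ q.1 <• q.2)
  exists_chart : ∀ x : M, ∃ φ : Bundle.Trivialization G π,
    x ∈ φ.baseSet ∧ IsBundleChart IG IM IP φ

/-- A smooth local section `σ : U → P` of `π` on the open set `U = dom`. The values of `toFun`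
outside `U` are irrelevant. -/
structure LocalSection (π : P → M) where
  dom : Set M
  isOpen_dom : IsOpen dom
  toFun : M → P
  smooth : ContMDiffOn IM IP ∞ toFun dom
  proj : ∀ x ∈ dom, π (toFun x) = x

/-- The pullback `σ^*α` of a `𝔤`-valued form on `P` along a local section; it is meaningful at the
points of `σ.dom`. -/
def LocalSection.pullback {IM : ModelWithCorners ℝ EM HM} {IP : ModelWithCorners ℝ EP HP}
    {IG : ModelWithCorners ℝ EG HG} {π : P → M}
    (σ : LocalSection IM IP π) (α : LieForm IG G IP P) : LieForm IG G IM M :=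
  fun x ↦ (α (σ.toFun x)).comp (mfderiv IM IP σ.toFun x)

/-- Given a family of local sections `σ i` on `U i`, a compatible family of local connection forms:
smooth `𝔤`-valued forms `α i` on `U i` such that, whenever `σ j = σ i · g` on `U i ∩ U j` for a
smooth `G`-valued function `g`, one has `α j = g^*θ + 𝔞𝔡_{g⁻¹} (α i)` on `U i ∩ U j`.
The values of `α i` outside `U i` are irrelevant. -/
structure IsCompatibleFamily [IsManifold IM ∞ M] {π : P → M} {ι : Type*}
    (σ : ι → LocalSection IM IP π) (α : ι → LieForm IG G IM M) : Prop where
  smooth : ∀ i, (α i).SmoothOn (σ i).dom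
  transition : ∀ (i j : ι) (g : M → G),
    ContMDiffOn IM IG ∞ g ((σ i).dom ∩ (σ j).dom) →
    (∀ x ∈ (σ i).dom ∩ (σ j).dom, (σ j).toFun x = (σ i).toFun x <• g x) →
    ∀ x ∈ (σ i).dom ∩ (σ j).dom,
      α j x = (maurerCartan IG (g x)).comp (mfderiv IM IG g x) + (ad IG (g x)⁻¹).comp (α i x)

/-- A connection given locally: a compatible family of local connection forms indexed by all the
local sections of `P`. -/
def IsLocalConnection [IsManifold IM ∞ M] {π : P → M}
    (α : LocalSection IM IP π → LieForm IG G IM M) : Prop :=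
  IsCompatibleFamily IG IM IP (fun σ : LocalSection IM IP π ↦ σ) α

/-- The fundamental vector field `A^*` of `A ∈ 𝔤`: `A^*_p ∈ T_{p·1}P = T_pP` is the image of `A`
under the differential at `1` of `g ↦ p · g`. -/
def fundamentalField (A : GroupLieAlgebra IG G) (p : P) : TangentSpace IP p :=
  (mfderiv IG IP (fun g : G ↦ p <• g) 1 :
    TangentSpace IG (1 : G) →L[ℝ] TangentSpace IP (p <• (1 : G))) A

/-- A principal connection form on `P`: a smooth `𝔤`-valued form `α` with `α(A^*) = A` for all
`A ∈ 𝔤` and `R_g^*α = 𝔞𝔡_{g⁻¹} α` for all `g ∈ G`, where `R_g(p) = p · g`. -/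
structure IsPrincipalConnection [IsManifold IP ∞ P] (α : LieForm IG G IP P) : Prop where
  smooth : α.SmoothOn Set.univ
  fundamental : ∀ (A : GroupLieAlgebra IG G) (p : P), α p (fundamentalField IG IP A p) = A
  equivariant : ∀ (g : G) (p : P),
    (α (p <• g)).comp (mfderiv IP IP (fun q : P ↦ q <• g) p) = (ad IG g⁻¹).comp (α p)

end Bundle

end PrincipalConn

end

/-! Over the domain of a local section `σ`, every point is `p = σ(π p) · h(p)` for a unique `h(p)`
in `G`, the fibre coordinate, and `h` is smooth because bundle charts are.

Everything rests on one product rule, `IsEquivariantForm.comp_diff_smul`: if `α` reproduces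
fundamental fields and is equivariant, then `(f · g)^*α = g^*θ + 𝔞𝔡_{g⁻¹} f^*α`. Applied to `τ = σ ·
g`, it is the transition law (1), so pullbacks of a connection form are compatible. Applied to `id =
(σ ∘ π) · h`, it forces `α = h^*θ + 𝔞𝔡_{h⁻¹} π^*β` whenever `σ^*α = β`; this gives uniqueness
(`LocalSection.eq_connForm`) and dictates the definition of `LocalSection.connForm`.

For existence, this formula inherits both axioms from `θ`, itself an equivariant form for `G` acting
on itself by right translation (`isEquivariantForm_mcForm`). The product rule on `G` then reads
`(fg)^*θ = g^*θ + 𝔞𝔡_{g⁻¹} f^*θ`. If `τ = σ · g`, the fibre coordinates satisfy `h_σ = (g ∘ π) h_τ`,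
and this rule combined with (1) shows that the two formulas agree on the overlap. The pieces
therefore glue over any cover; the family of all local sections is one such cover. -/

open scoped Manifold ContDiff RightActions

noncomputable section

namespace PrincipalConn

/-! ### Chain and product rules for differentials between model spaces -/

section Differential

variable {EN : Type*} [NormedAddCommGroup EN] [NormedSpace ℝ EN]
  {HN : Type*} [TopologicalSpace HN] (IN : ModelWithCorners ℝ EN HN)
  {N : Type*} [TopologicalSpace N] [ChartedSpace HN N]
  {EN' : Type*} [NormedAddCommGroup EN'] [NormedSpace ℝ EN']
  {HN' : Type*} [TopologicalSpace HN'] (IN' : ModelWithCorners ℝ EN' HN')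
  {N' : Type*} [TopologicalSpace N'] [ChartedSpace HN' N']
  {EQ : Type*} [NormedAddCommGroup EQ] [NormedSpace ℝ EQ]
  {HQ : Type*} [TopologicalSpace HQ] (IQ : ModelWithCorners ℝ EQ HQ)
  {Q : Type*} [TopologicalSpace Q] [ChartedSpace HQ Q]

/-- The differential `mfderiv`, as a map between the model spaces. Its type does not depend on the
points, so that these can be rewritten. -/
def diff (f : N → N') (x : N) : EN →L[ℝ] EN' := mfderiv IN IN' f x

variable {IN IN' IQ}

theorem diff_comp {g : N' → Q} {f : N → N'} {x : N} (hg : MDifferentiableAt IN' IQ g (f x))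
    (hf : MDifferentiableAt IN IN' f x) :
    diff IN IQ (fun y ↦ g (f y)) x = (diff IN' IQ g (f x)).comp (diff IN IN' f x) :=
  mfderiv_comp x hg hf

theorem diff_congr {f g : N → N'} {x : N} (h : f =ᶠ[nhds x] g) :
    diff IN IN' f x = diff IN IN' g x :=
  h.mfderiv_eq

variable (IN IN') in
theorem diff_const (y : N') (x : N) : diff IN IN' (fun _ ↦ y) x = 0 := mfderiv_const

variable (IN) in
theorem diff_id (x : N) : diff IN IN (fun y ↦ y) x = ContinuousLinearMap.id ℝ EN := mfderiv_id

theorem diff_prod {F : N × N' → Q} {ER : Type*} [NormedAddCommGroup ER] [NormedSpace ℝ ER]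
    {HR : Type*} [TopologicalSpace HR] {IR : ModelWithCorners ℝ ER HR}
    {R : Type*} [TopologicalSpace R] [ChartedSpace HR R] {f : R → N} {g : R → N'} {x : R}
    (hF : MDifferentiableAt (IN.prod IN') IQ F (f x, g x))
    (hf : MDifferentiableAt IR IN f x) (hg : MDifferentiableAt IR IN' g x) :
    diff IR IQ (fun y ↦ F (f y, g y)) x =
      (diff IN IQ (fun z ↦ F (z, g x)) (f x)).comp (diff IR IN f x) +
      (diff IN' IQ (fun z ↦ F (f x, z)) (g x)).comp (diff IR IN' g x) := by
  rw [diff_comp (g := F) (f := fun y ↦ (f y, g y)) hF (hf.prodMk hg)]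
  ext v
  have h1 : diff IR (IN.prod IN') (fun y ↦ (f y, g y)) x v =
      (diff IR IN f x v, diff IR IN' g x v) := by
    have := hf.mfderiv_prod hg
    exact congrArg (fun L : ER →L[ℝ] EN × EN' ↦ L v) this
  rw [ContinuousLinearMap.comp_apply, h1]
  exact mfderiv_prod_eq_add_apply hF

end Differential

/-! ### Smoothness of vector-valued forms in tangent coordinates -/

section Smooth

variable {EG : Type*} [NormedAddCommGroup EG] [NormedSpace ℝ EG]
  {HG : Type*} [TopologicalSpace HG] {IG : ModelWithCorners ℝ EG HG}
  {G : Type*} [TopologicalSpace G] [ChartedSpace HG G] [Group G]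
  {EN : Type*} [NormedAddCommGroup EN] [NormedSpace ℝ EN]
  {HN : Type*} [TopologicalSpace HN] {IN : ModelWithCorners ℝ EN HN}
  {N : Type*} [TopologicalSpace N] [ChartedSpace HN N]
  {EQ : Type*} [NormedAddCommGroup EQ] [NormedSpace ℝ EQ]
  {HQ : Type*} [TopologicalSpace HQ] {IQ : ModelWithCorners ℝ EQ HQ}
  {Q : Type*} [TopologicalSpace Q] [ChartedSpace HQ Q]

variable (IN) in
/-- The tangent coordinates at `x` given by the preferred chart at `x₀`. -/
def frame [IsManifold IN ∞ N] (x₀ x : N) : EN →L[ℝ] EN :=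
  (trivializationAt EN (TangentSpace IN : N → Type _) x₀).symmL ℝ x

variable (IN) in
/-- The inverse of `frame`. -/
def coframe [IsManifold IN ∞ N] (x₀ x : N) : EN →L[ℝ] EN :=
  (trivializationAt EN (TangentSpace IN : N → Type _) x₀).continuousLinearMapAt ℝ x

theorem frame_comp_coframe [IsManifold IN ∞ N] {x₀ x : N} (h : x ∈ (chartAt HN x₀).source) :
    (frame IN x₀ x).comp (coframe IN x₀ x) = ContinuousLinearMap.id ℝ EN := by
  ext v
  exact (trivializationAt EN (TangentSpace IN : N → Type _) x₀).symmL_continuousLinearMapAt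
    (R := ℝ) (b := x) (by simpa using h) v

variable (IN) in
theorem coframe_self [IsManifold IN ∞ N] (x₀ : N) :
    coframe IN x₀ x₀ = ContinuousLinearMap.id ℝ EN := by
  ext v
  change (trivializationAt EN (TangentSpace IN : N → Type _) x₀).continuousLinearMapAt ℝ x₀ v = v
  rw [TangentBundle.continuousLinearMapAt_trivializationAt_eq_core (mem_chart_source _ _)]
  exact (tangentBundleCore IN N).coordChange_self _ _ (mem_chart_source _ _) v

variable (IN) in
theorem frame_self [IsManifold IN ∞ N] (x₀ : N) :
    frame IN x₀ x₀ = ContinuousLinearMap.id ℝ EN := by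
  simpa [coframe_self] using frame_comp_coframe (IN := IN) (mem_chart_source HN x₀)

variable (IN) in
/-- Smoothness at a point of a form with values in a fixed vector space. -/
def SmoothFormAt [IsManifold IN ∞ N] (α : N → EN →L[ℝ] EG) (x₀ : N) : Prop :=
  ContMDiffAt IN 𝓘(ℝ, EN →L[ℝ] EG) ∞ (fun x ↦ (α x).comp (frame IN x₀ x)) x₀

/-- The target bundle is trivial, so in coordinates the form is just `α` composed with the frame;
openness of `U` turns smoothness within `U` into smoothness at its points. -/
theorem LieForm.smoothOn_iff [IsManifold IN ∞ N] {α : LieForm IG G IN N} {U : Set N}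
    (hU : IsOpen U) : α.SmoothOn U ↔ ∀ x ∈ U, SmoothFormAt (EG := EG) IN α x := by
  refine forall₂_congr fun x hx ↦ ?_
  have h : ∀ f : N → Bundle.TotalSpace (EN →L[ℝ] EG)
      (fun x : N ↦ TangentSpace IN x →L[ℝ] Bundle.Trivial N EG x),
      ContMDiffWithinAt IN (IN.prod 𝓘(ℝ, EN →L[ℝ] EG)) ∞ f U x ↔
        ContMDiffAt IN (IN.prod 𝓘(ℝ, EN →L[ℝ] EG)) ∞ f x :=
    fun f ↦ ⟨fun h ↦ h.contMDiffAt (hU.mem_nhds hx), fun h ↦ h.contMDiffWithinAt⟩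
  have e : ∀ y, ContinuousLinearMap.inCoordinates EN (TangentSpace IN) EG (Bundle.Trivial N EG)
      x y x y (α y) = (show EN →L[ℝ] EG from α y).comp (frame IN x y) := by
    intro y
    ext v
    simp only [ContinuousLinearMap.inCoordinates, Bundle.Trivial.fiberBundle_trivializationAt',
      Bundle.Trivial.continuousLinearMapAt_trivialization]
    rfl
  rw [h, contMDiffAt_hom_bundle]
  simp only [e]
  exact ⟨And.right, fun h ↦ ⟨contMDiffAt_id, h⟩⟩

theorem SmoothFormAt.congr [IsManifold IN ∞ N] {α β : N → EN →L[ℝ] EG} {x : N}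
    (hα : SmoothFormAt IN α x) (h : β =ᶠ[nhds x] α) : SmoothFormAt IN β x :=
  ContMDiffAt.congr_of_eventuallyEq hα (h.mono fun y hy ↦ by simp only [hy])

theorem SmoothFormAt.add [IsManifold IN ∞ N] {α β : N → EN →L[ℝ] EG} {x : N}
    (hα : SmoothFormAt IN α x) (hβ : SmoothFormAt IN β x) :
    SmoothFormAt IN (fun y ↦ α y + β y) x :=
  ContMDiffAt.add hα hβ

theorem SmoothFormAt.clm_comp [IsManifold IN ∞ N] {α : N → EN →L[ℝ] EG} {x : N}
    {L : N → EG →L[ℝ] EG}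
    (hL : ContMDiffAt IN 𝓘(ℝ, EG →L[ℝ] EG) ∞ L x) (hα : SmoothFormAt IN α x) :
    SmoothFormAt IN (fun y ↦ (L y).comp (α y)) x :=
  ContMDiffAt.clm_comp (f := fun y ↦ (α y).comp (frame IN x y)) hL hα

/-- Near `x`, frame times coframe at `f x` is the identity and can be inserted between `α` and the
differential of `f`. Both factors are then smooth coordinate expressions. -/
theorem SmoothFormAt.pullback [IsManifold IN ∞ N] [IsManifold IQ ∞ Q]
    {α : Q → EQ →L[ℝ] EG} {f : N → Q} {x : N}
    (hα : SmoothFormAt IQ α (f x)) (hf : ContMDiffAt IN IQ ∞ f x) :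
    SmoothFormAt IN (fun y ↦ (α (f y)).comp (diff IN IQ f y)) x := by
  have h1 := ContMDiffAt.mfderiv_const (m := ∞) hf le_rfl
  have h2 : ContMDiffAt IN 𝓘(ℝ, EQ →L[ℝ] EG) ∞ (fun y ↦ (α (f y)).comp (frame IQ (f x) (f y))) x :=
    ContMDiffAt.comp (g := fun z ↦ (α z).comp (frame IQ (f x) z)) x hα hf
  refine (h2.clm_comp h1).congr_of_eventuallyEq ?_
  filter_upwards [hf.continuousAt ((chartAt HQ (f x)).open_source.mem_nhds (mem_chart_source _ _))]
    with y hy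
  change _ = ((α (f y)).comp (frame IQ (f x) (f y))).comp ((coframe IQ (f x) (f y)).comp
    ((diff IN IQ f y).comp (frame IN x y)))
  ext v
  have := DFunLike.congr_fun (frame_comp_coframe (IN := IQ) hy) (diff IN IQ f y (frame IN x y v))
  exact congrArg (α (f y)) this.symm

/-- If a smooth family of maps `f y` satisfies `f y (g y) = c` then the differentials at `g y` are
smooth, with values in the fixed tangent space at `c`. -/
theorem contMDiffAt_diff_comp_frame [IsManifold IN ∞ N] [IsManifold IQ ∞ Q]
    {ER : Type*} [NormedAddCommGroup ER] [NormedSpace ℝ ER]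
    {HR : Type*} [TopologicalSpace HR] {IR : ModelWithCorners ℝ ER HR}
    {R : Type*} [TopologicalSpace R] [ChartedSpace HR R] [IsManifold IR ∞ R]
    {f : N → R → Q} {g : N → R} {x : N} {c : Q}
    (hf : ContMDiffAt (IN.prod IR) IQ ∞ (Function.uncurry f) (x, g x))
    (hg : ContMDiffAt IN IR ∞ g x) (hc : ∀ y, f y (g y) = c) :
    ContMDiffAt IN 𝓘(ℝ, ER →L[ℝ] EQ) ∞
      (fun y ↦ (diff IR IQ (f y) (g y)).comp (frame IR (g x) (g y))) x := by
  have h1 := ContMDiffAt.mfderiv (m := ∞) f g hf hg le_rfl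
  have h2 : ∀ y, inTangentCoordinates IR IQ g (fun y ↦ f y (g y))
      (fun y ↦ mfderiv IR IQ (f y) (g y)) x y =
      (coframe IQ (f x (g x)) (f y (g y))).comp
        ((diff IR IQ (f y) (g y)).comp (frame IR (g x) (g y))) := fun y ↦ rfl
  refine h1.congr_of_eventuallyEq (Filter.Eventually.of_forall fun y ↦ ?_)
  -- All values lie over the single point `c`, where the coframe is the identity, so no coordinate
  -- change remains on the target side.
  rw [h2, hc, hc, coframe_self, ContinuousLinearMap.id_comp]

end Smooth

/-! ### Right actions, the Maurer–Cartan form and the adjoint action -/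

section Action

variable {EG : Type*} [NormedAddCommGroup EG] [NormedSpace ℝ EG]
  {HG : Type*} [TopologicalSpace HG] {IG : ModelWithCorners ℝ EG HG}
  {G : Type*} [TopologicalSpace G] [ChartedSpace HG G] [Group G]
  {EP : Type*} [NormedAddCommGroup EP] [NormedSpace ℝ EP]
  {HP : Type*} [TopologicalSpace HP] {IP : ModelWithCorners ℝ EP HP}
  {P : Type*} [TopologicalSpace P] [ChartedSpace HP P] [MulAction Gᵐᵒᵖ P]
  {ER : Type*} [NormedAddCommGroup ER] [NormedSpace ℝ ER]
  {HR : Type*} [TopologicalSpace HR] {IR : ModelWithCorners ℝ ER HR}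
  {R : Type*} [TopologicalSpace R] [ChartedSpace HR R]

variable (IG) in
/-- The Maurer–Cartan form, as a linear map of the model space. -/
def mcForm (g : G) : EG →L[ℝ] EG := diff IG IG (fun h : G ↦ g⁻¹ * h) g

variable (IG) in
/-- The adjoint action, as a linear map of the model space. -/
def adjoint (g : G) : EG →L[ℝ] EG := diff IG IG (fun h : G ↦ g * h * g⁻¹) 1

variable (IG IP) in
/-- The two conditions on a connection form, apart from smoothness. -/
structure IsEquivariantForm (α : P → EP →L[ℝ] EG) : Prop where
  fundamental : ∀ p : P, (α p).comp (diff IG IP (fun g : G ↦ p <• g) 1) =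
    ContinuousLinearMap.id ℝ EG
  equivariant : ∀ (g : G) (p : P),
    (α (p <• g)).comp (diff IP IP (fun q : P ↦ q <• g) p) = (adjoint IG g⁻¹).comp (α p)

theorem isPrincipalConnection_iff [IsManifold IP ∞ P] {α : LieForm IG G IP P} :
    IsPrincipalConnection IG IP α ↔
      (∀ p, SmoothFormAt (EG := EG) IP α p) ∧ IsEquivariantForm (G := G) IG IP α := by
  constructor
  · intro h
    refine ⟨fun p ↦ (LieForm.smoothOn_iff isOpen_univ).1 h.smooth p trivial,
      fun p ↦ ?_, h.equivariant⟩
    ext A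
    exact h.fundamental A p
  · intro h
    exact ⟨(LieForm.smoothOn_iff isOpen_univ).2 fun p _ ↦ h.1 p,
      fun A p ↦ DFunLike.congr_fun (h.2.fundamental p) A, h.2.equivariant⟩

theorem mdifferentiable_smul_right
    (hact : ContMDiff (IP.prod IG) IP ∞ (fun q : P × G ↦ q.1 <• q.2)) (g : G) :
    MDifferentiable IP IP (fun p : P ↦ p <• g) :=
  (hact.comp (contMDiff_id.prodMk contMDiff_const)).mdifferentiable (by simp)

theorem mdifferentiable_smul_left
    (hact : ContMDiff (IP.prod IG) IP ∞ (fun q : P × G ↦ q.1 <• q.2)) (p : P) :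
    MDifferentiable IG IP (fun g : G ↦ p <• g) :=
  (hact.comp (contMDiff_const.prodMk contMDiff_id)).mdifferentiable (by simp)

variable (IG G) in
theorem adjoint_one : adjoint IG (1 : G) = ContinuousLinearMap.id ℝ EG := by
  simp [adjoint, diff_id]

variable [LieGroup IG ∞ G]

variable (IG G) in
theorem contMDiff_smul_self : ContMDiff (IG.prod IG) IG ∞ (fun q : G × G ↦ q.1 <• q.2) :=
  contMDiff_mul IG ∞

variable (IG) in
theorem mdifferentiable_leftMul (a : G) : MDifferentiable IG IG (fun h : G ↦ a * h) :=
  (contMDiff_mul_left (n := ∞) (I := IG)).mdifferentiable (by simp)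

variable (IG) in
theorem mdifferentiable_rightMul (a : G) : MDifferentiable IG IG (fun h : G ↦ h * a) :=
  (contMDiff_mul_right (n := ∞) (I := IG)).mdifferentiable (by simp)

variable (IG) in
theorem mdifferentiable_conj (a b : G) : MDifferentiable IG IG (fun h : G ↦ a * h * b) :=
  fun _ ↦ (mdifferentiable_rightMul IG b _).comp _ (mdifferentiable_leftMul IG a _)

/-- The product rule for a smooth right action. -/
theorem diff_smul (hact : ContMDiff (IP.prod IG) IP ∞ (fun q : P × G ↦ q.1 <• q.2))
    {f : R → P} {g : R → G} {x : R}
    (hf : MDifferentiableAt IR IP f x) (hg : MDifferentiableAt IR IG g x) :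
    diff IR IP (fun y ↦ f y <• g y) x =
      (diff IP IP (fun q : P ↦ q <• g x) (f x)).comp (diff IR IP f x) +
      (diff IG IP (fun h : G ↦ (f x <• g x) <• h) 1).comp
        ((mcForm IG (g x)).comp (diff IR IG g x)) := by
  rw [diff_prod (IN := IP) (IN' := IG) (F := fun q : P × G ↦ q.1 <• q.2)
    (hact.mdifferentiable (by simp) _) hf hg]
  congr 1
  rw [← ContinuousLinearMap.comp_assoc]
  congr 1
  -- The map `h ↦ f x · h` is left translation by `(g x)⁻¹` followed by the orbit map of `f x · g
  -- x`; the differential of the translation at `g x` is `θ`.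
  have h := diff_comp (x := g x) (mdifferentiable_smul_left hact (f x <• g x) _)
    (mdifferentiable_leftMul IG (g x)⁻¹ (g x))
  rw [inv_mul_cancel] at h
  rw [mcForm, ← h]
  congr 1
  funext h
  simp [smul_smul]

/-- In `diff_smul`, equivariance evaluates `α` on the first term and the fundamental-field condition
evaluates it on the second. -/
theorem IsEquivariantForm.comp_diff_smul {α : P → EP →L[ℝ] EG}
    (hα : IsEquivariantForm (G := G) IG IP α)
    (hact : ContMDiff (IP.prod IG) IP ∞ (fun q : P × G ↦ q.1 <• q.2))
    {f : R → P} {g : R → G} {x : R}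
    (hf : MDifferentiableAt IR IP f x) (hg : MDifferentiableAt IR IG g x) :
    (α (f x <• g x)).comp (diff IR IP (fun y ↦ f y <• g y) x) =
      (mcForm IG (g x)).comp (diff IR IG g x) +
        (adjoint IG (g x)⁻¹).comp ((α (f x)).comp (diff IR IP f x)) := by
  rw [diff_smul hact hf hg, ContinuousLinearMap.comp_add, ← ContinuousLinearMap.comp_assoc,
    hα.equivariant, ← ContinuousLinearMap.comp_assoc, hα.fundamental, add_comm,
    ContinuousLinearMap.id_comp, ContinuousLinearMap.comp_assoc]

variable (IG G) in
-- The two conditions differentiate the identities `a⁻¹(ag) = g` and `(ag)⁻¹(bg) = g⁻¹(a⁻¹b)g`.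
theorem isEquivariantForm_mcForm : IsEquivariantForm (P := G) (G := G) IG IG (mcForm IG) where
  fundamental a := by
    change (mcForm IG a).comp (diff IG IG (fun g : G ↦ a * g) 1) = _
    have h := diff_comp (x := (1 : G)) (mdifferentiable_leftMul IG a⁻¹ _)
      (mdifferentiable_leftMul IG a 1)
    simp only [inv_mul_cancel_left, mul_one] at h
    rw [mcForm, ← h, diff_id]
  equivariant g a := by
    change (mcForm IG (a * g)).comp (diff IG IG (fun q : G ↦ q * g) a) = _
    have h := diff_comp (x := a) (mdifferentiable_leftMul IG (a * g)⁻¹ _)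
      (mdifferentiable_rightMul IG g a)
    have h' := diff_comp (x := a) (mdifferentiable_conj IG g⁻¹ g⁻¹⁻¹ _)
      (mdifferentiable_leftMul IG a⁻¹ a)
    rw [inv_mul_cancel] at h'
    rw [mcForm, mcForm, adjoint, ← h, ← h']
    congr 1
    funext b
    group

/-- `(fg)^*θ = g^*θ + 𝔞𝔡_{g⁻¹} (f^*θ)`. -/
theorem mcForm_comp_diff_mul {f g : R → G} {x : R}
    (hf : MDifferentiableAt IR IG f x) (hg : MDifferentiableAt IR IG g x) :
    (mcForm IG (f x * g x)).comp (diff IR IG (fun y ↦ f y * g y) x) =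
      (mcForm IG (g x)).comp (diff IR IG g x) +
        (adjoint IG (g x)⁻¹).comp ((mcForm IG (f x)).comp (diff IR IG f x)) :=
  (isEquivariantForm_mcForm IG G).comp_diff_smul (contMDiff_smul_self IG G) hf hg

variable (IG) in
theorem adjoint_mul (a b : G) : adjoint IG (a * b) = (adjoint IG a).comp (adjoint IG b) := by
  have h := diff_comp (x := (1 : G)) (mdifferentiable_conj IG a a⁻¹ _)
    (mdifferentiable_conj IG b b⁻¹ 1)
  simp only [mul_one, mul_inv_cancel] at h
  rw [adjoint, adjoint, adjoint, ← h]
  congr 1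
  funext c
  group

/-- Conjugation fixes `1`, so `contMDiffAt_diff_comp_frame` applies with both base points constant.
-/
theorem contMDiffAt_adjoint [IsManifold IR ∞ R] {g : R → G} {x : R}
    (hg : ContMDiffAt IR IG ∞ g x) :
    ContMDiffAt IR 𝓘(ℝ, EG →L[ℝ] EG) ∞ (fun y ↦ adjoint IG (g y)) x := by
  have hg' : ContMDiffAt (IR.prod IG) IG ∞ (fun q : R × G ↦ g q.1) (x, 1) :=
    ContMDiffAt.comp (x, (1 : G)) hg contMDiffAt_fst
  have h := contMDiffAt_diff_comp_frame (IQ := IG) (IR := IG) (c := (1 : G))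
    (f := fun y (h : G) ↦ g y * h * (g y)⁻¹) (g := fun _ ↦ 1)
    ((hg'.mul contMDiffAt_snd).mul hg'.inv) contMDiffAt_const (by simp)
  simp only [frame_self, ContinuousLinearMap.comp_id] at h
  exact h

theorem smoothFormAt_mcForm (a : G) : SmoothFormAt IG (mcForm (G := G) IG) a :=
  contMDiffAt_diff_comp_frame (IQ := IG) (IR := IG) (c := (1 : G))
    (f := fun y (h : G) ↦ y⁻¹ * h) (g := fun y ↦ y)
    (contMDiffAt_fst.inv.mul contMDiffAt_snd) contMDiffAt_id (by simp)

end Action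

/-! ### Fibres, local sections and fibre coordinates -/

section Principal

variable {EG : Type*} [NormedAddCommGroup EG] [NormedSpace ℝ EG]
  {HG : Type*} [TopologicalSpace HG] {IG : ModelWithCorners ℝ EG HG}
  {G : Type*} [TopologicalSpace G] [ChartedSpace HG G] [Group G]
  {EM : Type*} [NormedAddCommGroup EM] [NormedSpace ℝ EM]
  {HM : Type*} [TopologicalSpace HM] {IM : ModelWithCorners ℝ EM HM}
  {M : Type*} [TopologicalSpace M] [ChartedSpace HM M]
  {EP : Type*} [NormedAddCommGroup EP] [NormedSpace ℝ EP]
  {HP : Type*} [TopologicalSpace HP] {IP : ModelWithCorners ℝ EP HP}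
  {P : Type*} [TopologicalSpace P] [ChartedSpace HP P] [MulAction Gᵐᵒᵖ P]
  {ER : Type*} [NormedAddCommGroup ER] [NormedSpace ℝ ER]
  {HR : Type*} [TopologicalSpace HR] {IR : ModelWithCorners ℝ ER HR}
  {R : Type*} [TopologicalSpace R] [ChartedSpace HR R]
  {π : P → M}

theorem IsPrincipalBundle.proj_smul (hπ : IsPrincipalBundle IG G IM IP π) (p : P) (g : G) :
    π (p <• g) = π p := by
  obtain ⟨φ, hx, hφ⟩ := hπ.exists_chart (π p)
  have hp := φ.mem_source.2 hx
  rw [← φ.coe_fst hp, ← φ.coe_fst (hφ.mem_source p hp g), hφ.equivariant p hp]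

theorem IsPrincipalBundle.exists_eq_smul (hπ : IsPrincipalBundle IG G IM IP π) {p q : P}
    (h : π p = π q) : ∃ g : G, q = p <• g := by
  obtain ⟨φ, hx, hφ⟩ := hπ.exists_chart (π p)
  have hp := φ.mem_source.2 hx
  have hq := φ.mem_source.2 (h ▸ hx)
  -- In a chart, `p` and `q` have the same base component, and the action is right multiplication on
  -- the `G` component.
  refine ⟨(φ p).2⁻¹ * (φ q).2, φ.injOn hq (hφ.mem_source p hp _) ?_⟩
  change φ q = φ _
  rw [hφ.equivariant p hp, mul_inv_cancel_left]
  exact Prod.ext (by rw [φ.coe_fst hp, φ.coe_fst hq, h]) rfl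

theorem IsPrincipalBundle.smul_left_cancel (hπ : IsPrincipalBundle IG G IM IP π) {p : P} {g h : G}
    (e : p <• g = p <• h) : g = h := by
  obtain ⟨φ, hx, hφ⟩ := hπ.exists_chart (π p)
  have hp := φ.mem_source.2 hx
  have := congrArg φ e
  rw [hφ.equivariant p hp, hφ.equivariant p hp] at this
  exact mul_left_cancel (Prod.ext_iff.1 this).2

open Classical in
/-- The element `g` with `q = p · g`, for `p` and `q` in the same fibre. -/
def ratio (p q : P) : G := if h : ∃ g : G, q = p <• g then h.choose else 1

theorem IsPrincipalBundle.smul_ratio (hπ : IsPrincipalBundle IG G IM IP π) {p q : P}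
    (h : π p = π q) : p <• (ratio p q : G) = q := by
  have := hπ.exists_eq_smul h
  rw [ratio, dif_pos this]
  exact this.choose_spec.symm

theorem IsPrincipalBundle.exists_localSection (hπ : IsPrincipalBundle IG G IM IP π) (x : M) :
    ∃ σ : LocalSection IM IP π, x ∈ σ.dom := by
  obtain ⟨φ, hx, hφ⟩ := hπ.exists_chart x
  refine ⟨⟨φ.baseSet, φ.open_baseSet, fun y ↦ φ.toOpenPartialHomeomorph.symm (y, 1), ?_, ?_⟩, hx⟩
  · exact hφ.smooth_symm.comp (contMDiff_id.prodMk contMDiff_const).contMDiffOn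
      fun y hy ↦ φ.mem_target.2 hy
  · exact fun y hy ↦ φ.proj_symm_apply (φ.mem_target.2 hy)

/-- The point `p` over the domain of `σ` is `σ (π p) · fibreCoord σ p`. -/
def LocalSection.fibreCoord (σ : LocalSection IM IP π) (p : P) : G := ratio (σ.toFun (π p)) p

theorem LocalSection.contMDiffAt (σ : LocalSection IM IP π) {x : M} (hx : x ∈ σ.dom) :
    ContMDiffAt IM IP ∞ σ.toFun x :=
  σ.smooth.contMDiffAt (σ.isOpen_dom.mem_nhds hx)

theorem LocalSection.smul_fibreCoord (σ : LocalSection IM IP π)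
    (hπ : IsPrincipalBundle IG G IM IP π) {p : P} (hp : π p ∈ σ.dom) :
    σ.toFun (π p) <• (σ.fibreCoord p : G) = p :=
  hπ.smul_ratio (σ.proj _ hp)

theorem LocalSection.fibreCoord_eq (σ : LocalSection IM IP π)
    (hπ : IsPrincipalBundle IG G IM IP π) {p : P} (hp : π p ∈ σ.dom) {g : G}
    (h : p = σ.toFun (π p) <• g) : σ.fibreCoord p = g :=
  hπ.smul_left_cancel ((σ.smul_fibreCoord hπ hp).trans h)

theorem LocalSection.fibreCoord_smul (σ : LocalSection IM IP π)
    (hπ : IsPrincipalBundle IG G IM IP π) {p : P} (hp : π p ∈ σ.dom) (g : G) :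
    σ.fibreCoord (p <• g) = (σ.fibreCoord p * g : G) := by
  apply σ.fibreCoord_eq hπ (by rwa [hπ.proj_smul])
  rw [hπ.proj_smul, MulOpposite.op_mul, mul_smul, σ.smul_fibreCoord hπ hp]

theorem LocalSection.fibreCoord_apply_self (σ : LocalSection IM IP π)
    (hπ : IsPrincipalBundle IG G IM IP π) {x : M} (hx : x ∈ σ.dom) :
    σ.fibreCoord (σ.toFun x) = (1 : G) := by
  apply σ.fibreCoord_eq hπ (by rwa [σ.proj x hx])
  rw [σ.proj x hx, MulOpposite.op_one, one_smul]

theorem LocalSection.preimage_dom_mem_nhds (σ : LocalSection IM IP π)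
    (hπ : IsPrincipalBundle IG G IM IP π) {p : P} (hp : π p ∈ σ.dom) :
    ∀ᶠ q in nhds p, π q ∈ σ.dom :=
  hπ.smooth_proj.continuous.continuousAt (σ.isOpen_dom.mem_nhds hp)

theorem IsPrincipalBundle.mdifferentiable_proj (hπ : IsPrincipalBundle IG G IM IP π) :
    MDifferentiable IP IM π :=
  hπ.smooth_proj.mdifferentiable (by simp)

theorem LocalSection.mdifferentiableAt (σ : LocalSection IM IP π) {x : M} (hx : x ∈ σ.dom) :
    MDifferentiableAt IM IP σ.toFun x :=
  (σ.contMDiffAt hx).mdifferentiableAt (by simp)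

/-! ### Smooth fibre coordinates and the connection form of one section -/

variable [LieGroup IG ∞ G]

/-- In a chart, `g` is the inverse `G` component of `f₁` times that of `f₂`. This supplies
smoothness for `ratio`, which is defined by choice. -/
theorem IsPrincipalBundle.contMDiffAt_of_eq_smul (hπ : IsPrincipalBundle IG G IM IP π)
    {f₁ f₂ : R → P} {g : R → G} {x : R} (h₁ : ContMDiffAt IR IP ∞ f₁ x)
    (h₂ : ContMDiffAt IR IP ∞ f₂ x) (h : ∀ᶠ y in nhds x, f₂ y = f₁ y <• g y) :
    ContMDiffAt IR IG ∞ g x := by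
  obtain ⟨φ, hx, hφ⟩ := hπ.exists_chart (π (f₁ x))
  have hp := φ.mem_source.2 hx
  have hq : f₂ x ∈ φ.source := by
    rw [h.self_of_nhds]
    exact hφ.mem_source _ hp _
  have s₁ := (hφ.smooth.contMDiffAt (φ.open_source.mem_nhds hp)).comp x h₁
  have s₂ := (hφ.smooth.contMDiffAt (φ.open_source.mem_nhds hq)).comp x h₂
  refine (s₁.snd.inv.mul s₂.snd).congr_of_eventuallyEq ?_
  filter_upwards [h, h₁.continuousAt (φ.open_source.mem_nhds hp)] with y hy hy'
  change g y = (φ (f₁ y)).2⁻¹ * (φ (f₂ y)).2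
  rw [hy, hφ.equivariant _ hy', inv_mul_cancel_left]

theorem LocalSection.contMDiffAt_fibreCoord (σ : LocalSection IM IP π)
    (hπ : IsPrincipalBundle IG G IM IP π) {p : P} (hp : π p ∈ σ.dom) :
    ContMDiffAt IP IG ∞ (σ.fibreCoord : P → G) p := by
  refine hπ.contMDiffAt_of_eq_smul (f₁ := fun q ↦ σ.toFun (π q)) (f₂ := fun q ↦ q)
    ((σ.contMDiffAt hp).comp p hπ.smooth_proj.contMDiffAt) contMDiffAt_id ?_
  filter_upwards [σ.preimage_dom_mem_nhds hπ hp] with q hq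
  exact (σ.smul_fibreCoord hπ hq).symm

theorem LocalSection.mdifferentiableAt_fibreCoord (σ : LocalSection IM IP π)
    (hπ : IsPrincipalBundle IG G IM IP π) {p : P} (hp : π p ∈ σ.dom) :
    MDifferentiableAt IP IG (σ.fibreCoord : P → G) p :=
  (σ.contMDiffAt_fibreCoord hπ hp).mdifferentiableAt (by simp)

variable (IG G) in
/-- The connection form over the domain of `σ` which is determined by the form `β`. -/
def LocalSection.connForm (σ : LocalSection IM IP π) (β : M → EM →L[ℝ] EG) (p : P) :
    EP →L[ℝ] EG :=
  (mcForm IG (σ.fibreCoord p : G)).comp (diff IP IG (σ.fibreCoord : P → G) p) +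
    (adjoint IG (σ.fibreCoord p : G)⁻¹).comp ((β (π p)).comp (diff IP IM π p))

/-- Along the orbit of `p` the projection is constant, which kills the `β` term, and the fibre
coordinate is a left translation, which `θ` inverts. -/
theorem LocalSection.connForm_fundamental (σ : LocalSection IM IP π) (β : M → EM →L[ℝ] EG)
    (hπ : IsPrincipalBundle IG G IM IP π)
    {p : P} (hp : π p ∈ σ.dom) :
    (σ.connForm IG G β p).comp (diff IG IP (fun g : G ↦ p <• g) 1) =
      ContinuousLinearMap.id ℝ EG := by
  have e : p <• (1 : G) = p := by simp
  have hs := mdifferentiable_smul_left hπ.smooth_action p (1 : G)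
  have h1 := diff_comp (g := (σ.fibreCoord : P → G)) (f := fun g : G ↦ p <• g) (x := (1 : G))
    (by rw [e]; exact σ.mdifferentiableAt_fibreCoord hπ hp) hs
  have h2 := diff_comp (f := fun g : G ↦ p <• g) (x := (1 : G)) (hπ.mdifferentiable_proj _) hs
  rw [e] at h1 h2
  simp only [hπ.proj_smul, diff_const] at h2
  simp only [σ.fibreCoord_smul hπ hp] at h1
  rw [connForm, ContinuousLinearMap.add_comp, ContinuousLinearMap.comp_assoc, ← h1,
    ContinuousLinearMap.comp_assoc, ContinuousLinearMap.comp_assoc, ← h2]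
  simpa using (isEquivariantForm_mcForm IG G).fundamental (σ.fibreCoord p)

/-- Moving by `g` multiplies the fibre coordinate by the constant `g` on the right and leaves `π`
unchanged. -/
theorem LocalSection.connForm_equivariant (σ : LocalSection IM IP π) (β : M → EM →L[ℝ] EG)
    (hπ : IsPrincipalBundle IG G IM IP π)
    {p : P} (hp : π p ∈ σ.dom) (g : G) :
    (σ.connForm IG G β (p <• g)).comp (diff IP IP (fun q : P ↦ q <• g) p) =
      (adjoint IG g⁻¹).comp (σ.connForm IG G β p) := by
  have hs := mdifferentiable_smul_right hπ.smooth_action g p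
  have h1 := diff_comp (g := (σ.fibreCoord : P → G)) (f := fun q : P ↦ q <• g) (x := p)
    (σ.mdifferentiableAt_fibreCoord hπ (by rwa [hπ.proj_smul])) hs
  have h2 := diff_comp (f := fun q : P ↦ q <• g) (x := p) (hπ.mdifferentiable_proj _) hs
  simp only [hπ.proj_smul] at h2
  rw [diff_congr (g := fun q ↦ (σ.fibreCoord q * g : G))
    ((σ.preimage_dom_mem_nhds hπ hp).mono fun q hq ↦ σ.fibreCoord_smul hπ hq g)] at h1
  rw [connForm, ContinuousLinearMap.add_comp, ContinuousLinearMap.comp_assoc, ← h1,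
    ContinuousLinearMap.comp_assoc, ContinuousLinearMap.comp_assoc, ← h2,
    σ.fibreCoord_smul hπ hp, hπ.proj_smul, mcForm_comp_diff_mul (g := fun _ ↦ g)
      (σ.mdifferentiableAt_fibreCoord hπ hp) mdifferentiableAt_const, diff_const, mul_inv_rev,
    adjoint_mul, connForm, ContinuousLinearMap.comp_add, ContinuousLinearMap.comp_assoc,
    ContinuousLinearMap.comp_zero, zero_add]

/-- Along `σ` the fibre coordinate is constantly `1`, so the `θ` term vanishes and the adjoint
factor is trivial, while `π ∘ σ` is the identity near `x`. -/
theorem LocalSection.connForm_pullback (σ : LocalSection IM IP π) (β : M → EM →L[ℝ] EG)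
    (hπ : IsPrincipalBundle IG G IM IP π)
    {x : M} (hx : x ∈ σ.dom) :
    (σ.connForm IG G β (σ.toFun x)).comp (diff IM IP σ.toFun x) = β x := by
  have e := σ.proj x hx
  have hs := σ.mdifferentiableAt hx
  have h1 := diff_comp (g := (σ.fibreCoord : P → G)) (x := x)
    (σ.mdifferentiableAt_fibreCoord hπ (by rwa [e])) hs
  have h2 := diff_comp (x := x) (hπ.mdifferentiable_proj _) hs
  have hU := σ.isOpen_dom.mem_nhds hx
  rw [diff_congr (g := fun _ ↦ (1 : G))
    (Filter.mem_of_superset hU fun y hy ↦ σ.fibreCoord_apply_self hπ hy), diff_const] at h1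
  rw [diff_congr (g := fun y ↦ y)
    (Filter.mem_of_superset hU fun y hy ↦ σ.proj y hy), diff_id] at h2
  rw [connForm, ContinuousLinearMap.add_comp, ContinuousLinearMap.comp_assoc, ← h1,
    ContinuousLinearMap.comp_assoc, ContinuousLinearMap.comp_assoc, ← h2,
    σ.fibreCoord_apply_self hπ hx, e, inv_one, adjoint_one]
  simp

theorem LocalSection.smoothFormAt_connForm [IsManifold IM ∞ M] [IsManifold IP ∞ P]
    (σ : LocalSection IM IP π) (β : M → EM →L[ℝ] EG)
    (hπ : IsPrincipalBundle IG G IM IP π)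
    {p : P} (hp : π p ∈ σ.dom) (hβ : SmoothFormAt IM β (π p)) :
    SmoothFormAt IP (σ.connForm IG G β) p :=
  ((smoothFormAt_mcForm _).pullback (σ.contMDiffAt_fibreCoord hπ hp)).add
    (.clm_comp (contMDiffAt_adjoint (σ.contMDiffAt_fibreCoord hπ hp).inv)
      (hβ.pullback hπ.smooth_proj.contMDiffAt))

/-- Uniqueness: this is the product rule for the identity of `P`, written near `p` as `(σ ∘ π) · h`.
-/
theorem LocalSection.eq_connForm (σ : LocalSection IM IP π) (β : M → EM →L[ℝ] EG)
    (hπ : IsPrincipalBundle IG G IM IP π)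
    {α : P → EP →L[ℝ] EG}
    (hα : IsEquivariantForm (G := G) IG IP α) {p : P} (hp : π p ∈ σ.dom)
    (hβ : β (π p) = (α (σ.toFun (π p))).comp (diff IM IP σ.toFun (π p))) :
    α p = σ.connForm IG G β p := by
  have hs := σ.mdifferentiableAt hp
  have h1 := diff_comp (x := p) hs (hπ.mdifferentiable_proj p)
  have h := hα.comp_diff_smul hπ.smooth_action (f := fun q ↦ σ.toFun (π q)) (x := p)
    (hs.comp p (hπ.mdifferentiable_proj p)) (σ.mdifferentiableAt_fibreCoord hπ hp)
  rw [diff_congr (g := fun q ↦ q)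
    ((σ.preimage_dom_mem_nhds hπ hp).mono fun q hq ↦ σ.smul_fibreCoord hπ hq), diff_id,
    σ.smul_fibreCoord hπ hp, h1, ContinuousLinearMap.comp_id] at h
  rw [h, connForm, hβ, ContinuousLinearMap.comp_assoc]

theorem LocalSection.connForm_eq_of_transition
    (hπ : IsPrincipalBundle IG G IM IP π) {σ τ : LocalSection IM IP π}
    {β γ : M → EM →L[ℝ] EG} {g : M → G} {p : P} (hp : π p ∈ σ.dom) (hp' : π p ∈ τ.dom)
    (hg : ContMDiffAt IM IG ∞ g (π p))
    (hτ : ∀ x ∈ σ.dom ∩ τ.dom, τ.toFun x = σ.toFun x <• g x)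
    (hγ : γ (π p) = (mcForm IG (g (π p))).comp (diff IM IG g (π p)) +
      (adjoint IG (g (π p))⁻¹).comp (β (π p))) :
    σ.connForm IG G β p = τ.connForm IG G γ p := by
  have key : ∀ q, π q ∈ σ.dom → π q ∈ τ.dom →
      σ.fibreCoord q = (g (π q) * τ.fibreCoord q : G) := by
    intro q h h'
    apply σ.fibreCoord_eq hπ h
    rw [MulOpposite.op_mul, mul_smul, ← hτ _ ⟨h, h'⟩, τ.smul_fibreCoord hπ h']
  have hg' : MDifferentiableAt IM IG g (π p) := hg.mdifferentiableAt (by simp)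
  have h1 := diff_comp (x := p) hg' (hπ.mdifferentiable_proj p)
  have h := mcForm_comp_diff_mul (f := fun q ↦ g (π q)) (g := τ.fibreCoord) (x := p)
    (hg'.comp p (hπ.mdifferentiable_proj p)) (τ.mdifferentiableAt_fibreCoord hπ hp')
  rw [connForm, key p hp hp', diff_congr (f := σ.fibreCoord)
    (g := fun q ↦ (g (π q) * τ.fibreCoord q : G)), h, h1, mul_inv_rev, adjoint_mul, connForm, hγ]
  · ext v
    simp [add_assoc]
  · filter_upwards [σ.preimage_dom_mem_nhds hπ hp, τ.preimage_dom_mem_nhds hπ hp'] with q h h'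
    exact key q h h'

/-! ### Gluing over a cover, and the converse -/

theorem IsCompatibleFamily.connForm_eq [IsManifold IM ∞ M]
    (hπ : IsPrincipalBundle IG G IM IP π) {ι : Type*} {σ : ι → LocalSection IM IP π}
    {β : ι → LieForm IG G IM M} (hβ : IsCompatibleFamily IG IM IP σ β) (i j : ι) {p : P}
    (hi : π p ∈ (σ i).dom) (hj : π p ∈ (σ j).dom) :
    (σ i).connForm IG G (β i) p = (σ j).connForm IG G (β j) p := by
  have hU : IsOpen ((σ i).dom ∩ (σ j).dom) := (σ i).isOpen_dom.inter (σ j).isOpen_dom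
  -- Compatibility only speaks of smooth transition functions that are given; the pointwise ratio
  -- provides one on the overlap.
  have e : ∀ x ∈ (σ i).dom ∩ (σ j).dom, (σ j).toFun x =
      (σ i).toFun x <• (ratio ((σ i).toFun x) ((σ j).toFun x) : G) := fun x hx ↦
    (hπ.smul_ratio (((σ i).proj x hx.1).trans ((σ j).proj x hx.2).symm)).symm
  have hg : ∀ x ∈ (σ i).dom ∩ (σ j).dom, ContMDiffAt IM IG ∞
      (fun x ↦ (ratio ((σ i).toFun x) ((σ j).toFun x) : G)) x := fun x hx ↦
    hπ.contMDiffAt_of_eq_smul ((σ i).contMDiffAt hx.1) ((σ j).contMDiffAt hx.2)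
      (Filter.mem_of_superset (hU.mem_nhds hx) e)
  exact LocalSection.connForm_eq_of_transition hπ hi hj (hg _ ⟨hi, hj⟩) e
    (hβ.transition i j _ (fun x hx ↦ (hg x hx).contMDiffWithinAt) e _ ⟨hi, hj⟩)

/-- A compatible family of local connection forms on a cover glues to a unique principal connection
form. -/
theorem IsCompatibleFamily.existsUnique [IsManifold IM ∞ M] [IsManifold IP ∞ P]
    (hπ : IsPrincipalBundle IG G IM IP π) {ι : Type*} {σ : ι → LocalSection IM IP π}
    {β : ι → LieForm IG G IM M} (hβ : IsCompatibleFamily IG IM IP σ β)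
    (hcov : ∀ x : M, ∃ i, x ∈ (σ i).dom) :
    ∃! α : LieForm IG G IP P, IsPrincipalConnection IG IP α ∧
      ∀ i, ∀ x ∈ (σ i).dom, β i x = (σ i).pullback α x := by
  choose k hk using hcov
  let α : LieForm IG G IP P := fun p ↦ (σ (k (π p))).connForm IG G (β (k (π p))) p
  have hα : ∀ i p, π p ∈ (σ i).dom → α p = (σ i).connForm IG G (β i) p :=
    fun i p hp ↦ IsCompatibleFamily.connForm_eq hπ hβ _ _ (hk _) hp
  refine ⟨α, ⟨isPrincipalConnection_iff.2 ⟨fun p ↦ ?_, fun p ↦ ?_, fun g p ↦ ?_⟩,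
    fun i x hx ↦ ?_⟩, fun α' h ↦ ?_⟩
  · have hp := hk (π p)
    -- The chosen index `k (π q)` may jump with `q`; near `p` the form is rewritten with the index
    -- fixed at `k (π p)`.
    refine ((σ (k (π p))).smoothFormAt_connForm _ hπ hp
      ((LieForm.smoothOn_iff (σ _).isOpen_dom).1 (hβ.smooth _) _ hp)).congr ?_
    filter_upwards [(σ (k (π p))).preimage_dom_mem_nhds hπ hp] with q hq using hα _ q hq
  · exact (σ (k (π p))).connForm_fundamental _ hπ (hk _)
  · rw [hα (k (π p)) (p <• g) (by rw [hπ.proj_smul]; exact hk _)]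
    exact (σ (k (π p))).connForm_equivariant _ hπ (hk _) g
  · have h := (σ i).connForm_pullback (EG := EG) (β i) hπ hx
    change _ = ContinuousLinearMap.comp (α ((σ i).toFun x)) _
    rw [hα i _ (by rwa [(σ i).proj x hx])]
    exact h.symm
  · funext p
    exact (σ (k (π p))).eq_connForm _ hπ (isPrincipalConnection_iff.1 h.1).2 (hk _)
      (h.2 _ _ (hk _))

/-- The pullbacks of a principal connection form along local sections are a compatible family. -/
theorem IsPrincipalConnection.isLocalConnection [IsManifold IM ∞ M] [IsManifold IP ∞ P]
    (hπ : IsPrincipalBundle IG G IM IP π) {α : LieForm IG G IP P}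
    (h : IsPrincipalConnection IG IP α) :
    IsLocalConnection IG IM IP (fun σ : LocalSection IM IP π ↦ σ.pullback α) where
  smooth σ := (LieForm.smoothOn_iff σ.isOpen_dom).2 fun x hx ↦
    ((isPrincipalConnection_iff.1 h).1 _).pullback (σ.contMDiffAt hx)
  transition σ τ g hg e x hx := by
    have hU := (σ.isOpen_dom.inter τ.isOpen_dom).mem_nhds hx
    have := (isPrincipalConnection_iff.1 h).2.comp_diff_smul hπ.smooth_action
      (σ.mdifferentiableAt hx.1)
      ((hg.contMDiffAt hU).mdifferentiableAt (by simp))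
    rw [← diff_congr (f := τ.toFun) (Filter.mem_of_superset hU e), ← e x hx] at this
    exact this

end Principal

end PrincipalConn

end

open PrincipalConn in
theorem mainTheorem6
    {EG : Type*} [NormedAddCommGroup EG] [NormedSpace ℝ EG] [FiniteDimensional ℝ EG]
    {HG : Type*} [TopologicalSpace HG] (IG : ModelWithCorners ℝ EG HG) [IG.Boundaryless]
    {G : Type*} [TopologicalSpace G] [ChartedSpace HG G] [Group G] [LieGroup IG ∞ G]
    {EM : Type*} [NormedAddCommGroup EM] [NormedSpace ℝ EM] [FiniteDimensional ℝ EM]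
    {HM : Type*} [TopologicalSpace HM] (IM : ModelWithCorners ℝ EM HM) [IM.Boundaryless]
    {M : Type*} [TopologicalSpace M] [ChartedSpace HM M] [IsManifold IM ∞ M]
    {EP : Type*} [NormedAddCommGroup EP] [NormedSpace ℝ EP] [FiniteDimensional ℝ EP]
    {HP : Type*} [TopologicalSpace HP] (IP : ModelWithCorners ℝ EP HP) [IP.Boundaryless]
    {P : Type*} [TopologicalSpace P] [ChartedSpace HP P] [IsManifold IP ∞ P]
    [MulAction Gᵐᵒᵖ P] (π : P → M) (hπ : IsPrincipalBundle IG G IM IP π) :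
    -- a local connection glues to a unique principal connection form
    (∀ β : LocalSection IM IP π → LieForm IG G IM M, IsLocalConnection IG IM IP β →
      ∃! α : LieForm IG G IP P, IsPrincipalConnection IG IP α ∧
        ∀ σ : LocalSection IM IP π, ∀ x ∈ σ.dom, β σ x = σ.pullback α x) ∧
    -- conversely, the pullbacks of a principal connection form are a local connection
    (∀ α : LieForm IG G IP P, IsPrincipalConnection IG IP α →
      IsLocalConnection IG IM IP (fun σ : LocalSection IM IP π ↦ σ.pullback α)) ∧
    -- for the gluing, local sections whose domains cover `M` suffice
    (∀ (ι : Type*) (σ : ι → LocalSection IM IP π) (β : ι → LieForm IG G IM M),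
      (∀ x : M, ∃ i, x ∈ (σ i).dom) → IsCompatibleFamily IG IM IP σ β →
      ∃! α : LieForm IG G IP P, IsPrincipalConnection IG IP α ∧
        ∀ i, ∀ x ∈ (σ i).dom, β i x = (σ i).pullback α x) := by
  exact ⟨fun β hβ ↦ IsCompatibleFamily.existsUnique hπ hβ hπ.exists_localSection,
    fun α hα ↦ IsPrincipalConnection.isLocalConnection hπ hα,
    fun ι σ β hcov hβ ↦ IsCompatibleFamily.existsUnique hπ hβ hcov⟩
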